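/- Let $\langle A,B\rangle=\operatorname{tr}(A^{\top}B)$ and $|A|=\langle A,A\rangle^{1/2}$ be the Euclidean inner product and norm on the space $\mathbb M^2$ of real $2\times2$ matrices, and let $\operatorname{cof}A$ denote the cofactor matrix of $A$. Let $A:\mathbb R\to\mathbb M^2$ be a $C^2$ curve with $\det A(t)=1$ for all $t\in\mathbb R$ that solves $$\ddot A(t)=\lambda(t)\operatorname{cof}A(t),\qquad t\in\mathbb R,$$ for some continuous $\lambda:\mathbb R\to\mathbb R$. (This is the equation $\ddot A+\kappa A=\lambda\operatorname{cof}A$ of affine motion of a planar incompressible fluid surrounded by vacuum in the case of perfect fluids, $\kappa=0$.) Then one of the following holds: 1. $A$ is rigid, that is, $|A(t)|$ is constant in $t\in\mathbb R$; 2. $|A(t)|$ increases to $\infty$ as $|t|\to\infty$: there is $t_0\in\mathbb R$ such that $|A|$ is strictly decreasing on $(-\infty,t_0]$ and strictly increasing on $[t_0,\infty)$, and $|A(t)|\to\infty$ as $t\to-\infty$ and as $t\to\infty$; 3. $\langle A(t),\dot A(t)\rangle>0$ for all $t\in\mathbb R$, $|A|$ is strictly increasing on $\mathbb R$, $|A(t)|\to\infty$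 as $t\to\infty$, and $|A(t)|\to\sqrt2$ as $t\to-\infty$; 4. $\langle A(t),\dot A(t)\rangle<0$ for all $t\in\mathbb R$, $|A|$ is strictly decreasing on $\mathbb R$, $|A(t)|\to\infty$ as $t\to-\infty$, and $|A(t)|\to\sqrt2$ as $t\to\infty$. -/

import Mathlib

open Filter Topology Set

namespace AffineMotion

/-- The space of real `2 × 2` matrices. -/
abbrev Mat2 : Type := Matrix (Fin 2) (Fin 2) ℝ

/-- The Euclidean inner product `⟨A, B⟩ = tr (Aᵀ B) = ∑ i j, A i j * B i j`. -/
def ip (A B : Mat2) : ℝ := (A.transpose * B).trace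

/-- The Euclidean norm `|A| = ⟨A, A⟩ ^ (1/2)`. -/
noncomputable def euclNorm (A : Mat2) : ℝ := Real.sqrt (ip A A)

/-- The cofactor matrix, i.e. the transpose of the adjugate. -/
def cof (A : Mat2) : Mat2 := A.adjugate.transpose

/-- The time derivative of a curve of matrices, taken entry by entry. It is only used for curves
whose entries are differentiable. -/
noncomputable def dot (A : ℝ → Mat2) (t : ℝ) : Mat2 :=
  Matrix.of fun i j => deriv (fun s => A s i j) t

/-- `A` is a twice continuously differentiable curve in `SL(2, ℝ)`, defined for all times, that
solves `A'' + κ A = lam cof A` for some continuous scalar function `lam`. -/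
structure IsSolution (κ : ℝ) (A : ℝ → Mat2) : Prop where
  contDiff : ∀ i j, ContDiff ℝ 2 (fun t => A t i j)
  det_eq_one : ∀ t, (A t).det = 1
  equation : ∃ lam : ℝ → ℝ, Continuous lam ∧
    ∀ t, dot (dot A) t + κ • A t = lam t • cof (A t)

/-- A curve of matrices is rigid if its norm is constant in time. -/
def IsRigid (A : ℝ → Mat2) : Prop := ∃ c : ℝ, ∀ t, euclNorm (A t) = c

end AffineMotion

/-!
Write `A = !![p + q, r + s; r - s, p - q]` and put `P = (p, s)`, `Q = (q, r)`. The constraint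
`det A = 1` becomes `|P|² - |Q|² = 1`, and the equation `A'' = lam cof A` splits into `P'' = lam P`,
`Q'' = -lam Q`. Hence the energy `E = |P'|² + |Q'|²` and the two angular momenta `m₁ = p s' - s p'`
and `m₂ = q r' - r q'` are conserved. With `x = |Q|²` one has `|A|² = 2 + 4 x`, and elimination of
the angles gives the autonomous equations
`(1 + 2 x) x'² = 4 f(x)` and `(1 + 2 x) x'' = 2 f'(x) - x'²`, where
`f(y) = E y² + (E - m₁² - m₂²) y - m₂²`. Moreover
`(1 + 2 x) x'' = 2 ((1 + x) |Q'|² + x |P'|²) ≥ 0`, so `x` is convex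
(`IsSolution.exists_radialMotion`). The theorem is then a statement about `x` alone.

* If `x' = x'' = 0` at some time, the value `x₀` of `x` there is a double root of `f`, so
  `|x'| ≤ C |x - x₀|` and `x` is constant (`RadialMotion.eq_of_critical_of_flat`).
* If `x` is not constant but `x'` vanishes at `t₀`, then `x''(t₀) > 0`, so by convexity `x'` changes
  sign exactly at `t₀` and `x` grows at least linearly in both directions.
* If `x' > 0` throughout, convexity gives `x → ∞` at `+∞`, while `x` decreases to some `L ≥ 0` at
  `-∞`. Then `x'` and `x''` tend to `0` there, so `L` is a double root of `f`; thus
  `f(0) = E L²`, and since `f(0) = -m₂² ≤ 0` this forces `L = 0`, that is `|A| → √2`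
  (`RadialMotion.tendsto_zero_atBot`). The case `x' < 0` follows by time reversal.
-/

namespace AffineMotion

/-! ### Calculus on the line -/

/-- Uniqueness for `x' = O(x - x₀)`: with `u = (x - x₀)²`, the function `u e^{-2Kt}` is antitone and
`u e^{2Kt}` is monotone, so `u` vanishes identically as soon as it vanishes once. -/
lemma eq_of_abs_deriv_le {x v : ℝ → ℝ} (hx : ∀ t, HasDerivAt x (v t) t) {K x₀ t₀ : ℝ}
    (hv : ∀ t, |v t| ≤ K * |x t - x₀|) (h₀ : x t₀ = x₀) (t : ℝ) : x t = x₀ := by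
  have key : ∀ s, |(x s - x₀) * v s| ≤ K * (x s - x₀) ^ 2 := fun s => by
    rw [abs_mul, ← sq_abs (x s - x₀)]
    nlinarith [mul_le_mul_of_nonneg_left (hv s) (abs_nonneg (x s - x₀))]
  have hd : ∀ k s, HasDerivAt (fun s => (x s - x₀) ^ 2 * Real.exp (k * s))
      ((2 * ((x s - x₀) * v s) + k * (x s - x₀) ^ 2) * Real.exp (k * s)) s := fun k s => by
    have h1 := (((hx s).sub_const x₀).pow 2).mul (((hasDerivAt_id s).const_mul k).exp)
    refine h1.congr_deriv ?_
    simp only [Pi.pow_apply, id, Nat.cast_ofNat]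
    ring
  have hle : (x t - x₀) ^ 2 ≤ 0 := by
    rcases le_total t₀ t with h | h
    · have hanti : Antitone (fun s => (x s - x₀) ^ 2 * Real.exp ((-(2 * K)) * s)) :=
        antitone_of_hasDerivAt_nonpos (fun s => hd _ s) fun s =>
          mul_nonpos_of_nonpos_of_nonneg (by linarith [(abs_le.1 (key s)).2]) (Real.exp_pos _).le
      have := hanti h
      simp only [h₀, sub_self, ne_eq, OfNat.ofNat_ne_zero, not_false_eq_true, zero_pow,
        zero_mul] at this
      exact nonpos_of_mul_nonpos_left this (Real.exp_pos _)
    · have hmono : Monotone (fun s => (x s - x₀) ^ 2 * Real.exp ((2 * K) * s)) :=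
        monotone_of_hasDerivAt_nonneg (fun s => hd _ s) fun s =>
          mul_nonneg (by linarith [(abs_le.1 (key s)).1]) (Real.exp_pos _).le
      have := hmono h
      simp only [h₀, sub_self, ne_eq, OfNat.ofNat_ne_zero, not_false_eq_true, zero_pow,
        zero_mul] at this
      exact nonpos_of_mul_nonpos_left this (Real.exp_pos _)
  nlinarith [pow_eq_zero_iff (two_ne_zero) |>.1 (le_antisymm hle (sq_nonneg _))]

lemma tendsto_atTop_of_monotone_deriv {x v : ℝ → ℝ} (hx : ∀ t, HasDerivAt x (v t) t)
    (hv : Monotone v) {t₁ : ℝ} (h₁ : 0 < v t₁) : Tendsto x atTop atTop := by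
  have hlin : Tendsto (fun t => x t₁ + v t₁ * (t - t₁)) atTop atTop :=
    tendsto_atTop_add_const_left _ _
      ((tendsto_atTop_add_const_right _ (-t₁) tendsto_id).const_mul_atTop h₁)
  refine tendsto_atTop_mono' _ ?_ hlin
  filter_upwards [eventually_gt_atTop t₁] with t ht
  obtain ⟨c, hc, hcs⟩ := exists_hasDerivAt_eq_slope x v ht
    (fun s _ => (hx s).continuousAt.continuousWithinAt) (fun s _ => hx s)
  have hpos : 0 < t - t₁ := sub_pos.2 ht
  rw [eq_div_iff hpos.ne'] at hcs
  nlinarith [mul_le_mul_of_nonneg_right (hv hc.1.le) hpos.le]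

/-- If a function and its derivative both converge at `-∞`, the derivative converges to `0`. -/
lemma deriv_limit_eq_zero_atBot {y g : ℝ → ℝ} (hy : ∀ t, HasDerivAt y (g t) t) {L l : ℝ}
    (hL : Tendsto y atBot (𝓝 L)) (hl : Tendsto g atBot (𝓝 l)) : l = 0 := by
  have hmv : ∀ t, ∃ c ∈ Ioo t (t + 1), g c = y (t + 1) - y t := fun t => by
    obtain ⟨c, hc, h⟩ := exists_hasDerivAt_eq_slope y g (lt_add_one t)
      (fun s _ => (hy s).continuousAt.continuousWithinAt) (fun s _ => hy s)
    exact ⟨c, hc, by simpa using h⟩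
  choose c hc hg using hmv
  have hshift : Tendsto (fun t : ℝ => t + 1) atBot atBot :=
    tendsto_atBot_add_const_right _ _ tendsto_id
  have hc' : Tendsto c atBot atBot := tendsto_atBot_mono (fun t => (hc t).2.le) hshift
  have h1 : Tendsto (fun t => g (c t)) atBot (𝓝 l) := hl.comp hc'
  have h2 : Tendsto (fun t => y (t + 1) - y t) atBot (𝓝 (L - L)) := (hL.comp hshift).sub hL
  simp only [hg] at h1
  simpa using tendsto_nhds_unique h1 h2

lemma exists_tendsto_atBot_of_monotone_nonneg {y : ℝ → ℝ} (hy : Monotone y) (h0 : ∀ t, 0 ≤ y t) :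
    ∃ L, 0 ≤ L ∧ Tendsto y atBot (𝓝 L) :=
  ⟨⨅ t, y t, le_ciInf h0, tendsto_atBot_ciInf hy ⟨0, by rintro _ ⟨t, rfl⟩; exact h0 t⟩⟩

/-! ### The radial equation -/

/-- The scalar motion obtained by eliminating the angular variables: `x` is a nonnegative convex
function with first and second derivatives `v` and `w`, which satisfies
`(1 + 2 x) x'² = 4 f(x)` and its differentiated form, where `f(y) = E y² + b y - c`. The second
equation is a separate field because it follows from the first only where `x' ≠ 0`. -/
structure RadialMotion (x v w : ℝ → ℝ) (E b c : ℝ) : Prop where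
  hasDerivAt : ∀ t, HasDerivAt x (v t) t
  hasDerivAt' : ∀ t, HasDerivAt v (w t) t
  nonneg : ∀ t, 0 ≤ x t
  convex : ∀ t, 0 ≤ w t
  energy_nonneg : 0 ≤ E
  momentum_nonneg : 0 ≤ c
  first_order : ∀ t, (1 + 2 * x t) * v t ^ 2 = 4 * (E * x t ^ 2 + b * x t - c)
  second_order : ∀ t, (1 + 2 * x t) * w t = 2 * (2 * E * x t + b) - v t ^ 2

namespace RadialMotion

variable {x v w : ℝ → ℝ} {E b c : ℝ}

/-- Time reversal. -/
lemma reverse (h : RadialMotion x v w E b c) :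
    RadialMotion (fun t => x (-t)) (fun t => -v (-t)) (fun t => w (-t)) E b c where
  hasDerivAt t := ((h.hasDerivAt (-t)).comp t (hasDerivAt_neg t)).congr_deriv (by ring)
  hasDerivAt' t := ((h.hasDerivAt' (-t)).comp t (hasDerivAt_neg t)).neg.congr_deriv (by ring)
  nonneg t := h.nonneg _
  convex t := h.convex _
  energy_nonneg := h.energy_nonneg
  momentum_nonneg := h.momentum_nonneg
  first_order t := by simpa using h.first_order (-t)
  second_order t := by simpa using h.second_order (-t)

lemma monotone_velocity (h : RadialMotion x v w E b c) : Monotone v :=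
  monotone_of_hasDerivAt_nonneg h.hasDerivAt' h.convex

/-- At a critical time with vanishing second derivative, the position is a double root of `f`; the
first-order equation then reads `(1 + 2 x) x'² = 4 E (x - x₀)²`, which forces `x` to be constant. -/
lemma eq_of_critical_of_flat (h : RadialMotion x v w E b c) {s : ℝ} (hv : v s = 0) (hw : w s = 0)
    (t : ℝ) : x t = x s := by
  have h1 := h.first_order s
  have h2 := h.second_order s
  rw [hv] at h1 h2
  rw [hw] at h2
  refine eq_of_abs_deriv_le h.hasDerivAt (K := 2 * √E) (t₀ := s) (fun τ => ?_) rfl t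
  have h3 := h.first_order τ
  have hb : b = -(2 * E * x s) := by linarith
  have hc : c = -(E * x s ^ 2) := by subst hb; nlinarith
  have h4 : v τ ^ 2 ≤ 4 * E * (x τ - x s) ^ 2 := by
    have h5 : (1 + 2 * x τ) * v τ ^ 2 = 4 * E * (x τ - x s) ^ 2 := by
      rw [h3, hb, hc]; ring
    nlinarith [mul_nonneg (h.nonneg τ) (sq_nonneg (v τ))]
  refine abs_le_of_sq_le_sq ?_ (by positivity)
  rw [mul_pow, mul_pow, Real.sq_sqrt h.energy_nonneg, sq_abs]
  linarith

lemma velocity_pos_of_critical (h : RadialMotion x v w E b c) (hne : ¬ ∀ t s, x t = x s) {t₀ t : ℝ}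
    (h₀ : v t₀ = 0) (ht : t₀ < t) : 0 < v t := by
  refine lt_of_le_of_ne (h₀ ▸ h.monotone_velocity ht.le) fun h0 => hne ?_
  -- Otherwise `v = 0` on `[t₀, t]`, and the two-sided derivative of `v` at `t₀` is `0`.
  have hz : ∀ s ∈ Icc t₀ t, v s = 0 := fun s hs =>
    le_antisymm (h0 ▸ h.monotone_velocity hs.2) (h₀ ▸ h.monotone_velocity hs.1)
  have hd : HasDerivWithinAt v 0 (Icc t₀ t) t₀ :=
    (hasDerivWithinAt_const t₀ (Icc t₀ t) (0 : ℝ)).congr hz h₀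
  have hw : w t₀ = 0 :=
    (uniqueDiffOn_Icc ht t₀ (left_mem_Icc.2 ht.le)).eq_deriv _
      (h.hasDerivAt' t₀).hasDerivWithinAt hd
  exact fun a a' => (h.eq_of_critical_of_flat h₀ hw a).trans
    (h.eq_of_critical_of_flat h₀ hw a').symm

lemma strictMonoOn_of_critical (h : RadialMotion x v w E b c) (hne : ¬ ∀ t s, x t = x s) {t₀ : ℝ}
    (h₀ : v t₀ = 0) : StrictMonoOn x (Ici t₀) ∧ Tendsto x atTop atTop := by
  refine ⟨strictMonoOn_of_deriv_pos (convex_Ici t₀)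
    (fun s _ => (h.hasDerivAt s).continuousAt.continuousWithinAt) fun s hs => ?_,
    tendsto_atTop_of_monotone_deriv h.hasDerivAt h.monotone_velocity
      (h.velocity_pos_of_critical hne h₀ (lt_add_one t₀))⟩
  rw [(h.hasDerivAt s).deriv]
  exact h.velocity_pos_of_critical hne h₀ (by simpa using hs)

/-- A motion that increases for all times emanates from `0`: its limit at `-∞` is a double root `L`
of `f`, and `f(0) = E L²` is incompatible with `f(0) ≤ 0` unless `L = 0`. -/
lemma tendsto_zero_atBot (h : RadialMotion x v w E b c) (hv : ∀ t, 0 < v t) :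
    Tendsto x atBot (𝓝 0) := by
  obtain ⟨L, hL0, hL⟩ := exists_tendsto_atBot_of_monotone_nonneg
    (monotone_of_hasDerivAt_nonneg h.hasDerivAt fun t => (hv t).le) h.nonneg
  obtain ⟨l, -, hl⟩ := exists_tendsto_atBot_of_monotone_nonneg h.monotone_velocity
    fun t => (hv t).le
  obtain rfl := deriv_limit_eq_zero_atBot h.hasDerivAt hL hl
  have hpos : 0 < 1 + 2 * L := by linarith
  have hweq : w = fun t => (2 * (2 * E * x t + b) - v t ^ 2) / (1 + 2 * x t) := by
    funext t
    rw [eq_div_iff (by linarith [h.nonneg t]), ← h.second_order t, mul_comm]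
  have hwlim : Tendsto w atBot (𝓝 ((2 * (2 * E * L + b) - 0 ^ 2) / (1 + 2 * L))) := by
    rw [hweq]
    exact ((((hL.const_mul (2 * E)).add_const b).const_mul 2).sub (hl.pow 2)).div
      ((hL.const_mul 2).const_add 1) hpos.ne'
  have hf' : 2 * E * L + b = 0 := by
    have := deriv_limit_eq_zero_atBot h.hasDerivAt' hl hwlim
    rw [div_eq_zero_iff] at this
    rcases this with h1 | h1 <;> linarith
  have hf : E * L ^ 2 + b * L - c = 0 := by
    have h1 : Tendsto (fun t => (1 + 2 * x t) * v t ^ 2) atBot (𝓝 ((1 + 2 * L) * 0 ^ 2)) :=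
      ((hL.const_mul 2).const_add 1).mul (hl.pow 2)
    simp only [h.first_order] at h1
    have h2 : Tendsto (fun t => 4 * (E * x t ^ 2 + b * x t - c)) atBot
        (𝓝 (4 * (E * L ^ 2 + b * L - c))) :=
      ((((hL.pow 2).const_mul E).add (hL.const_mul b)).sub_const c).const_mul 4
    have := tendsto_nhds_unique h1 h2
    linarith
  have hb : b = -(2 * E * L) := by linarith
  have hc : c = -(E * L ^ 2) := by subst hb; linarith
  have hEL : E * L ^ 2 = 0 :=
    le_antisymm (by linarith [h.momentum_nonneg]) (mul_nonneg h.energy_nonneg (sq_nonneg L))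
  rcases mul_eq_zero.1 hEL with hE | hL'
  · -- For `E = 0` the polynomial `f` vanishes identically, contrary to `x' > 0`.
    have h1 := h.first_order 0
    rw [hc, hb, hE] at h1
    have : 0 < (1 + 2 * x 0) * v 0 ^ 2 :=
      mul_pos (by linarith [h.nonneg 0]) (pow_pos (hv 0) 2)
    linarith
  · rwa [pow_eq_zero_iff two_ne_zero |>.1 hL'] at hL

lemma increasing (h : RadialMotion x v w E b c) (hv : ∀ t, 0 < v t) :
    StrictMono x ∧ Tendsto x atTop atTop ∧ Tendsto x atBot (𝓝 0) :=
  ⟨strictMono_of_hasDerivAt_pos h.hasDerivAt hv,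
    tendsto_atTop_of_monotone_deriv h.hasDerivAt h.monotone_velocity (hv 0),
    h.tendsto_zero_atBot hv⟩

/-- The four possible behaviours of a radial motion. -/
lemma classification (h : RadialMotion x v w E b c) :
    (∀ t s, x t = x s) ∨
    ((∃ t₀, StrictAntiOn x (Iic t₀) ∧ StrictMonoOn x (Ici t₀)) ∧
      Tendsto x atBot atTop ∧ Tendsto x atTop atTop) ∨
    ((∀ t, 0 < v t) ∧ StrictMono x ∧ Tendsto x atTop atTop ∧ Tendsto x atBot (𝓝 0)) ∨
    ((∀ t, v t < 0) ∧ StrictAnti x ∧ Tendsto x atBot atTop ∧ Tendsto x atTop (𝓝 0)) := by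
  by_cases hne : ∀ t s, x t = x s
  · exact Or.inl hne
  right
  by_cases hcrit : ∃ t₀, v t₀ = 0
  · left
    obtain ⟨t₀, h₀⟩ := hcrit
    obtain ⟨hmono, htop⟩ := h.strictMonoOn_of_critical hne h₀
    obtain ⟨hanti, hbot⟩ := h.reverse.strictMonoOn_of_critical (t₀ := -t₀)
      (fun hc => hne fun t s => by simpa using hc (-t) (-s)) (by simpa using h₀)
    refine ⟨⟨t₀, fun s hs t ht hst => ?_, hmono⟩, ?_, htop⟩
    · simpa using hanti (neg_le_neg (mem_Iic.1 ht)) (neg_le_neg (mem_Iic.1 hs)) (neg_lt_neg hst)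
    · simpa [Function.comp_def] using hbot.comp tendsto_neg_atBot_atTop
  · right
    push Not at hcrit
    have hcont : Continuous v :=
      continuous_iff_continuousAt.2 fun t => (h.hasDerivAt' t).continuousAt
    by_cases hpos : ∀ t, 0 < v t
    · exact Or.inl ⟨hpos, h.increasing hpos⟩
    · right
      push Not at hpos
      obtain ⟨a, ha⟩ := hpos
      have hneg : ∀ t, v t < 0 := fun t => by
        by_contra! ht
        obtain ⟨s, hs⟩ := mem_range_of_exists_le_of_exists_ge hcont ⟨a, ha⟩ ⟨t, ht⟩
        exact hcrit s hs
      obtain ⟨h1, h2, h3⟩ := h.reverse.increasing fun t => neg_pos.2 (hneg (-t))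
      refine ⟨hneg, fun s t hst => ?_, ?_, ?_⟩
      · simpa using h1 (neg_lt_neg hst)
      · simpa [Function.comp_def] using h2.comp tendsto_neg_atBot_atTop
      · simpa [Function.comp_def] using h3.comp tendsto_neg_atTop_atBot

end RadialMotion

/-! ### Reduction to the radial equation -/

/-- Elimination of the angles for a pair of planar motions `P = (p, s)`, `Q = (q, r)` driven by
opposite central forces under the constraint `|P|² - |Q|² = 1`. -/
lemma exists_radialMotion_of_central {p s q r p' s' q' r' lam : ℝ → ℝ}
    (hp : ∀ t, HasDerivAt p (p' t) t) (hs : ∀ t, HasDerivAt s (s' t) t)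
    (hq : ∀ t, HasDerivAt q (q' t) t) (hr : ∀ t, HasDerivAt r (r' t) t)
    (hp' : ∀ t, HasDerivAt p' (lam t * p t) t) (hs' : ∀ t, HasDerivAt s' (lam t * s t) t)
    (hq' : ∀ t, HasDerivAt q' (-(lam t * q t)) t) (hr' : ∀ t, HasDerivAt r' (-(lam t * r t)) t)
    (hdet : ∀ t, p t ^ 2 + s t ^ 2 - (q t ^ 2 + r t ^ 2) = 1) :
    ∃ w E b c, RadialMotion (fun t => q t ^ 2 + r t ^ 2)
      (fun t => 2 * (q t * q' t + r t * r' t)) w E b c := by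
  have const : ∀ F : ℝ → ℝ, (∀ t, HasDerivAt F 0 t) → ∀ t, F t = F 0 := fun F hF t =>
    is_const_of_deriv_eq_zero (fun t => (hF t).differentiableAt) (fun t => (hF t).deriv) t 0
  -- The constraint, differentiated once and twice.
  have hdet' : ∀ t, p t * p' t + s t * s' t = q t * q' t + r t * r' t := fun t => by
    have h1 : HasDerivAt (fun t => p t ^ 2 + s t ^ 2 - (q t ^ 2 + r t ^ 2)) 0 t := by
      simp only [hdet]; exact hasDerivAt_const _ _
    have h2 := ((((hp t).pow 2).add ((hs t).pow 2)).sub (((hq t).pow 2).add ((hr t).pow 2)))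
    have := h1.unique h2
    norm_num at this
    linarith
  have hlam : ∀ t, lam t * (1 + 2 * (q t ^ 2 + r t ^ 2))
      = q' t ^ 2 + r' t ^ 2 - (p' t ^ 2 + s' t ^ 2) := fun t => by
    have h1 : HasDerivAt (fun t => p t * p' t + s t * s' t - (q t * q' t + r t * r' t)) 0 t := by
      simp only [hdet', sub_self]; exact hasDerivAt_const _ _
    have h2 := ((((hp t).mul (hp' t)).add ((hs t).mul (hs' t))).sub
      (((hq t).mul (hq' t)).add ((hr t).mul (hr' t))))
    have := h1.unique h2
    linear_combination -this - lam t * hdet t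
  have hE := const (fun t => p' t ^ 2 + s' t ^ 2 + (q' t ^ 2 + r' t ^ 2)) fun t => by
    refine ((((hp' t).pow 2).add ((hs' t).pow 2)).add
      (((hq' t).pow 2).add ((hr' t).pow 2))).congr_deriv ?_
    norm_num
    linear_combination 2 * lam t * hdet' t
  have hm₁ := const (fun t => p t * s' t - s t * p' t) fun t =>
    (((hp t).mul (hs' t)).sub ((hs t).mul (hp' t))).congr_deriv (by ring)
  have hm₂ := const (fun t => q t * r' t - r t * q' t) fun t =>
    (((hq t).mul (hr' t)).sub ((hr t).mul (hq' t))).congr_deriv (by ring)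
  set E := p' 0 ^ 2 + s' 0 ^ 2 + (q' 0 ^ 2 + r' 0 ^ 2)
  set m₁ := p 0 * s' 0 - s 0 * p' 0
  set m₂ := q 0 * r' 0 - r 0 * q' 0
  -- Lagrange's identity in each of the two planes.
  have hlag₁ : ∀ t, (q t * q' t + r t * r' t) ^ 2 + m₁ ^ 2
      = (1 + (q t ^ 2 + r t ^ 2)) * (p' t ^ 2 + s' t ^ 2) := fun t => by
    rw [← hm₁ t, ← hdet' t]
    linear_combination (p' t ^ 2 + s' t ^ 2) * hdet t
  have hlag₂ : ∀ t, (q t * q' t + r t * r' t) ^ 2 + m₂ ^ 2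
      = (q t ^ 2 + r t ^ 2) * (q' t ^ 2 + r' t ^ 2) := fun t => by
    rw [← hm₂ t]; ring
  have hconv : ∀ t, (1 + 2 * (q t ^ 2 + r t ^ 2)) *
      (2 * (q' t ^ 2 + r' t ^ 2) - 2 * lam t * (q t ^ 2 + r t ^ 2))
      = 2 * ((1 + (q t ^ 2 + r t ^ 2)) * (q' t ^ 2 + r' t ^ 2)
        + (q t ^ 2 + r t ^ 2) * (p' t ^ 2 + s' t ^ 2)) := fun t => by
    linear_combination (-2 * (q t ^ 2 + r t ^ 2)) * hlam t
  refine ⟨fun t => 2 * (q' t ^ 2 + r' t ^ 2) - 2 * lam t * (q t ^ 2 + r t ^ 2), E,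
    E - m₁ ^ 2 - m₂ ^ 2, m₂ ^ 2, ?_⟩
  constructor
  · intro t
    refine (((hq t).pow 2).add ((hr t).pow 2)).congr_deriv ?_
    norm_num
    ring
  · intro t
    refine ((((hq t).mul (hq' t)).add ((hr t).mul (hr' t))).const_mul 2).congr_deriv ?_
    ring
  · intro t; positivity
  · intro t
    have hpos : 0 < 1 + 2 * (q t ^ 2 + r t ^ 2) := by positivity
    refine (mul_nonneg_iff_of_pos_left hpos).1 ?_
    rw [hconv t]
    positivity
  · positivity
  · positivity
  · intro t
    linear_combination (4 * (q t ^ 2 + r t ^ 2)) * hlag₁ t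
      + (4 * (1 + (q t ^ 2 + r t ^ 2))) * hlag₂ t
      + (4 * (q t ^ 2 + r t ^ 2) * (1 + (q t ^ 2 + r t ^ 2))) * hE t
  · intro t
    linear_combination hconv t + 2 * hlag₁ t + 2 * hlag₂ t
      + (2 * (1 + 2 * (q t ^ 2 + r t ^ 2))) * hE t

lemma ip_eq (A B : Mat2) :
    ip A B = A 0 0 * B 0 0 + A 0 1 * B 0 1 + A 1 0 * B 1 0 + A 1 1 * B 1 1 := by
  simp only [ip, Matrix.trace_fin_two, Matrix.mul_apply, Fin.sum_univ_two, Matrix.transpose_apply]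
  ring

/-- The witness `x` is half the squared norm of the component of `A` orthogonal to the matrices
`!![p, s; -s, p]`; it vanishes exactly when `A` is a rotation. -/
lemma IsSolution.exists_radialMotion {A : ℝ → Mat2} (hA : IsSolution 0 A) :
    ∃ x v w E b c, RadialMotion x v w E b c ∧
      (∀ t, euclNorm (A t) = √(2 + 4 * x t)) ∧ ∀ t, ip (A t) (dot A t) = 2 * v t := by
  obtain ⟨lam, -, heq⟩ := hA.equation
  have hd : ∀ i j t, HasDerivAt (fun t => A t i j) (dot A t i j) t := fun i j t =>
    ((hA.contDiff i j).differentiable (by norm_num) t).hasDerivAt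
  have hdd : ∀ i j t, HasDerivAt (fun t => dot A t i j) (lam t * cof (A t) i j) t :=
    fun i j t => by
    have h1 : ContDiff ℝ 1 (deriv fun s => A s i j) :=
      ((contDiff_succ_iff_deriv (n := 1)).1 (hA.contDiff i j)).2.2
    have h2 : HasDerivAt (fun t => dot A t i j) (dot (dot A) t i j) t :=
      (h1.differentiable (by norm_num) t).hasDerivAt
    have h3 := congrFun (congrFun (heq t) i) j
    simp only [zero_smul, add_zero, Matrix.smul_apply, smul_eq_mul] at h3
    rwa [h3] at h2
  have hdet : ∀ t, A t 0 0 * A t 1 1 - A t 0 1 * A t 1 0 = 1 := fun t => by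
    rw [← Matrix.det_fin_two]; exact hA.det_eq_one t
  have c00 : ∀ t, cof (A t) 0 0 = A t 1 1 := fun t => by simp [cof, Matrix.adjugate_fin_two]
  have c01 : ∀ t, cof (A t) 0 1 = -A t 1 0 := fun t => by simp [cof, Matrix.adjugate_fin_two]
  have c10 : ∀ t, cof (A t) 1 0 = -A t 0 1 := fun t => by simp [cof, Matrix.adjugate_fin_two]
  have c11 : ∀ t, cof (A t) 1 1 = A t 0 0 := fun t => by simp [cof, Matrix.adjugate_fin_two]
  obtain ⟨w, E, b, c, h⟩ := exists_radialMotion_of_central (lam := lam)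
    (fun t => ((hd 0 0 t).add (hd 1 1 t)).div_const 2)
    (fun t => ((hd 0 1 t).sub (hd 1 0 t)).div_const 2)
    (fun t => ((hd 0 0 t).sub (hd 1 1 t)).div_const 2)
    (fun t => ((hd 0 1 t).add (hd 1 0 t)).div_const 2)
    (fun t => (((hdd 0 0 t).add (hdd 1 1 t)).div_const 2).congr_deriv
      (by simp only [c00, c11, Pi.add_apply]; ring))
    (fun t => (((hdd 0 1 t).sub (hdd 1 0 t)).div_const 2).congr_deriv
      (by simp only [c01, c10, Pi.sub_apply]; ring))
    (fun t => (((hdd 0 0 t).sub (hdd 1 1 t)).div_const 2).congr_deriv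
      (by simp only [c00, c11, Pi.sub_apply]; ring))
    (fun t => (((hdd 0 1 t).add (hdd 1 0 t)).div_const 2).congr_deriv
      (by simp only [c01, c10, Pi.add_apply]; ring))
    (fun t => by simp only [Pi.add_apply, Pi.sub_apply]; linear_combination hdet t)
  refine ⟨_, _, w, E, b, c, h, fun t => ?_, fun t => ?_⟩
  · rw [euclNorm, ip_eq]
    congr 1
    simp only [Pi.add_apply, Pi.sub_apply]
    linear_combination 2 * hdet t
  · have h1 : HasDerivAt (fun t => A t 0 0 * A t 1 1 - A t 0 1 * A t 1 0) 0 t := by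
      simp only [hdet]; exact hasDerivAt_const _ _
    have h2 := h1.unique (((hd 0 0 t).mul (hd 1 1 t)).sub ((hd 0 1 t).mul (hd 1 0 t)))
    rw [ip_eq]
    simp only [Pi.add_apply, Pi.sub_apply]
    linear_combination -h2

end AffineMotion

theorem theorem12p1 (A : ℝ → AffineMotion.Mat2) (hA : AffineMotion.IsSolution 0 A) :
    AffineMotion.IsRigid A ∨
    ((∃ t₀ : ℝ, StrictAntiOn (fun t => AffineMotion.euclNorm (A t)) (Iic t₀) ∧
        StrictMonoOn (fun t => AffineMotion.euclNorm (A t)) (Ici t₀)) ∧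
      Tendsto (fun t => AffineMotion.euclNorm (A t)) atBot atTop ∧
      Tendsto (fun t => AffineMotion.euclNorm (A t)) atTop atTop) ∨
    ((∀ t, 0 < AffineMotion.ip (A t) (AffineMotion.dot A t)) ∧
      StrictMono (fun t => AffineMotion.euclNorm (A t)) ∧
      Tendsto (fun t => AffineMotion.euclNorm (A t)) atTop atTop ∧
      Tendsto (fun t => AffineMotion.euclNorm (A t)) atBot (𝓝 (Real.sqrt 2))) ∨
    ((∀ t, AffineMotion.ip (A t) (AffineMotion.dot A t) < 0) ∧
      StrictAnti (fun t => AffineMotion.euclNorm (A t)) ∧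
      Tendsto (fun t => AffineMotion.euclNorm (A t)) atBot atTop ∧
      Tendsto (fun t => AffineMotion.euclNorm (A t)) atTop (𝓝 (Real.sqrt 2))) := by
  obtain ⟨x, v, w, E, b, c, h, hnorm, hip⟩ := hA.exists_radialMotion
  simp only [AffineMotion.IsRigid, hnorm, hip]
  have hlt : ∀ {s t}, x s < x t → √(2 + 4 * x s) < √(2 + 4 * x t) := fun {s t} hst =>
    Real.sqrt_lt_sqrt (by linarith [h.nonneg s]) (by linarith)
  have htop : ∀ {l : Filter ℝ}, Tendsto x l atTop →
      Tendsto (fun t => √(2 + 4 * x t)) l atTop := fun hl =>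
    Real.tendsto_sqrt_atTop.comp
      (tendsto_atTop_add_const_left _ _ (hl.const_mul_atTop (by norm_num)))
  have hzero : ∀ {l : Filter ℝ}, Tendsto x l (𝓝 0) →
      Tendsto (fun t => √(2 + 4 * x t)) l (𝓝 √2) := fun hl => by
    simpa using ((hl.const_mul 4).const_add 2).sqrt
  rcases h.classification with h1 | ⟨⟨t₀, h1, h2⟩, h3, h4⟩ | ⟨h1, h2, h3, h4⟩ | ⟨h1, h2, h3, h4⟩
  · exact Or.inl ⟨√(2 + 4 * x 0), fun t => by rw [h1 t 0]⟩
  · exact Or.inr (Or.inl ⟨⟨t₀, fun s hs t ht hst => hlt (h1 hs ht hst),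
      fun s hs t ht hst => hlt (h2 hs ht hst)⟩, htop h3, htop h4⟩)
  · exact Or.inr (Or.inr (Or.inl ⟨fun t => by linarith [h1 t], fun s t hst => hlt (h2 hst),
      htop h3, hzero h4⟩))
  · exact Or.inr (Or.inr (Or.inr ⟨fun t => by linarith [h1 t], fun s t hst => hlt (h2 hst),
      htop h3, hzero h4⟩))
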